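/- For positive integers $m,n$ let $P_k$ be the path and $C_k$ the cycle on $k$ vertices, and let $\square$ denote the Cartesian product of graphs. Let $G_{m,n}=P_{m+1}\,\square\,P_{n+1}$ be the plane quadratic lattice graph with $m+1$ rows and $n+1$ columns; let $H_{n,m}=P_{m+1}\,\square\,C_n$ be the cylindrical quadratic lattice graph, obtained from $G_{m,n}$ by identifying its left and right columns; and let $S_{n,m}=C_m\,\square\,C_n$ be the toroidal quadratic lattice graph, obtained from $H_{n,m}$ by identifying its top and bottom cycles. The entropy constant of a doubly indexed family of finite graphs is the double limit $$\lim_{m,n\to\infty} f(m,n)^{1/k(m,n)},$$ where $f(m,n)$ is the number of independent sets (including the empty set) and $k(m,n)$ the number of vertices of the graph with indices $m,n$. The entropy constants of the plane, cylindrical and toroidal quadratic lattices $(G_{m,n})$, $(H_{n,m})$, $(S_{n,m})$ all exist and are equal. Their common value $\eta$ lies between $1.503047782\ldots$ and $1.5035148\ldots$; precisely, $$1.503047782<\eta<1.5035149 .$$ -/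

import Mathlib

open Filter Topology

/-- The number of independent sets of a graph (the empty set counts as independent). -/
noncomputable def numIndepSets {V : Type} (G : SimpleGraph V) : ℕ :=
  Set.ncard {s : Set V | G.IsIndepSet s}

/-- The plane quadratic lattice graph with `m + 1` rows and `n + 1` columns. -/
def planeLattice (m n : ℕ) : SimpleGraph (Fin (m + 1) × Fin (n + 1)) :=
  (SimpleGraph.pathGraph (m + 1)).boxProd (SimpleGraph.pathGraph (n + 1))

/-- The cylindrical quadratic lattice graph: the leftmost and the rightmost column of
`planeLattice m n` are identified, so that `m + 1` rows remain, each of which is a cycle through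
`n` columns. -/
def cylinderLattice (m n : ℕ) : SimpleGraph (Fin (m + 1) × Fin n) :=
  (SimpleGraph.pathGraph (m + 1)).boxProd (SimpleGraph.cycleGraph n)

/-- The toroidal quadratic lattice graph: the top and the bottom row of `cylinderLattice m n` are
identified too, so that `m` rows and `n` columns remain, all of which are cycles. -/
def torusLattice (m n : ℕ) : SimpleGraph (Fin m × Fin n) :=
  (SimpleGraph.cycleGraph m).boxProd (SimpleGraph.cycleGraph n)

/-- `η` is the entropy constant of the doubly indexed family `G` of finite graphs: with `f m n`
the number of independent sets and `k m n` the number of vertices of `G m n`, the double limit of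
`(f m n) ^ (1 / k m n)` as `m` and `n` tend to infinity independently exists and equals `η`. -/
def IsEntropyConstant {V : ℕ → ℕ → Type} (G : ∀ m n : ℕ, SimpleGraph (V m n)) (η : ℝ) : Prop :=
  Tendsto (fun p : ℕ × ℕ => (numIndepSets (G p.1 p.2) : ℝ) ^ (1 / (Nat.card (V p.1 p.2) : ℝ)))
    (atTop ×ˢ atTop) (𝓝 η)

/-!
Write `F(m, n)` for the number of independent sets of the grid `P_m □ P_n`.

*Existence and equality.* A grid is covered by translates of a smaller one, so
`F(m, n) ≤ F(p, q) ^ ((m / p + 1) * (n / q + 1))` (`gridCount_le_pow`). As in Fekete's lemma,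
`log F(m, n) / (m n)` therefore converges to its infimum, `logEntropy`, as `m` and `n` grow
independently (`tendsto_log_gridCount`). Deleting one row and one column from a torus, or one
column from a cylinder, leaves a grid as an induced subgraph, while the grid of the same size has
fewer edges. So the numbers for cylinder and torus lie between those of two grids of almost equal
size, and the three limits agree.

*Numerical bounds.* For the transfer matrix `T` of a graph `G`, which is symmetric, the number of
independent sets of `G □ P_{k+1}` is the sum `u_k` of the entries of `T ^ k`, and the number of
those of `G □ C_n` is the trace of `T ^ n`.
* Submultiplicativity of the Frobenius norm gives `tr T ^ (2qk) ≤ (tr T ^ (2q)) ^ k`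
  (`trace_pow_le`). With `G = P_m` this bounds the entropy by the growth rate of the cylinders
  `P_m □ C_{2q}` of fixed circumference (`logEntropy_le_log_div`); here `2q = 6`.
* The Cauchy–Schwarz inequality `u_{i+j}² ≤ u_{2i} u_{2j}` implies that
  `(u_{2q+1} / u_{2q}) ^ (2k)` is at most `u_{2q+2k} / u_{2q}` (`powSum_pow_le`). With `G = P_m` this
  bounds the entropy from below by the ratio of the growth rates of the strips of widths `2q + 2` and `2q + 1`
  (`log_div_le_logEntropy`); here `q = 3`.

The growth rates of the three families of strips are estimated by Collatz–Wielandt bounds: an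
explicit positive vector `v` with `T v ≤ c v` or `T v ≥ c v`, indexed by the independent sets of
`P_7`, `P_8` and `C_6`. These are coded as binary numbers, so that disjointness is the vanishing
of a bitwise `and`.
-/

namespace LatticeEntropy

/-! ### Comparing numbers of independent sets -/

theorem numIndepSets_eq_card {V : Type} (G : SimpleGraph V) :
    numIndepSets G = Nat.card {s : Set V // G.IsIndepSet s} :=
  (Nat.card_coe_set_eq _).symm

theorem numIndepSets_pos {V : Type} [Finite V] (G : SimpleGraph V) : 0 < numIndepSets G := by
  have : Nonempty {s : Set V // G.IsIndepSet s} := ⟨∅, by simp [SimpleGraph.IsIndepSet]⟩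
  rw [numIndepSets_eq_card]
  exact Nat.card_pos

theorem isIndepSet_preimage {V W : Type} {G : SimpleGraph V} {H : SimpleGraph W} (a : G →g H)
    {s : Set W} (hs : H.IsIndepSet s) : G.IsIndepSet (a ⁻¹' s) := by
  intro x hx y hy _ hxy
  exact hs hx hy (a.map_adj hxy).ne (a.map_adj hxy)

/-- If the graph `G` is covered by homomorphic images of `G₀`, an independent set of `G` is
determined by its preimages, which are independent in `G₀`. -/
theorem numIndepSets_le_pow {V V₀ ι : Type} [Finite V₀] [Fintype ι] {G : SimpleGraph V}
    {G₀ : SimpleGraph V₀} (a : ι → G₀ →g G) (hcover : ∀ x, ∃ i y, a i y = x) :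
    numIndepSets G ≤ numIndepSets G₀ ^ Fintype.card ι := by
  rw [numIndepSets_eq_card, numIndepSets_eq_card, ← Nat.card_eq_fintype_card, ← Nat.card_fun]
  refine Nat.card_le_card_of_injective
    (fun s i => ⟨a i ⁻¹' s.1, isIndepSet_preimage (a i) s.2⟩) ?_
  intro s t hst
  ext x
  obtain ⟨i, y, rfl⟩ := hcover x
  have := congrArg Subtype.val (congrFun hst i)
  exact Set.ext_iff.mp this y

theorem numIndepSets_le_of_surjective {V W : Type} [Finite V] {G : SimpleGraph V}
    {H : SimpleGraph W} (a : G →g H) (ha : Function.Surjective a) :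
    numIndepSets H ≤ numIndepSets G := by
  simpa using numIndepSets_le_pow (fun _ : Unit => a) fun x => ⟨(), ha x⟩

theorem numIndepSets_congr {V W : Type} [Finite V] [Finite W] {G : SimpleGraph V}
    {H : SimpleGraph W} (e : G ≃g H) : numIndepSets G = numIndepSets H :=
  le_antisymm (numIndepSets_le_of_surjective e.symm.toHom e.symm.surjective)
    (numIndepSets_le_of_surjective e.toHom e.surjective)

/-- The image of an independent set stays independent under an injection that reflects
adjacency. -/
theorem numIndepSets_le_of_reflects {V W : Type} [Finite W] {G : SimpleGraph V}
    {H : SimpleGraph W} (e : V → W) (he : Function.Injective e)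
    (hadj : ∀ x y, H.Adj (e x) (e y) → G.Adj x y) : numIndepSets G ≤ numIndepSets H := by
  rw [numIndepSets_eq_card, numIndepSets_eq_card]
  refine Nat.card_le_card_of_injective (fun s => ⟨e '' s.1, ?_⟩) ?_
  · rintro _ ⟨x, hx, rfl⟩ _ ⟨y, hy, rfl⟩ hne hxy
    exact s.2 hx hy (fun h => hne (h ▸ rfl)) (hadj x y hxy)
  · intro s t hst
    exact Subtype.ext (he.image_injective (congrArg Subtype.val hst))

/-- The number of independent sets of the `m × n` grid `P_m □ P_n`. -/
noncomputable def gridCount (m n : ℕ) : ℕ :=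
  numIndepSets ((SimpleGraph.pathGraph m).boxProd (SimpleGraph.pathGraph n))

theorem gridCount_pos (m n : ℕ) : 0 < gridCount m n := numIndepSets_pos _

theorem gridCount_comm (m n : ℕ) : gridCount m n = gridCount n m :=
  numIndepSets_congr (SimpleGraph.boxProdComm _ _)

/-- The product of two graph homomorphisms, between box products. -/
def boxProdMap {V V' W W' : Type} {G : SimpleGraph V} {G' : SimpleGraph V'} {H : SimpleGraph W}
    {H' : SimpleGraph W'} (a : G →g G') (b : H →g H') : G.boxProd H →g G'.boxProd H' where
  toFun x := (a x.1, b x.2)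
  map_rel' := by
    rintro ⟨x₁, x₂⟩ ⟨y₁, y₂⟩ (⟨h, h'⟩ | ⟨h, h'⟩)
    · exact Or.inl ⟨a.map_adj h, congrArg b h'⟩
    · exact Or.inr ⟨b.map_adj h, congrArg a h'⟩

/-- The translate by `j * p` of the path on `p` vertices inside the path on `m` vertices, moved
back to the last `p` vertices when it would stick out. -/
def pathTile {p m : ℕ} (h : p ≤ m) (j : ℕ) :
    SimpleGraph.pathGraph p →g SimpleGraph.pathGraph m where
  toFun x := ⟨min (j * p) (m - p) + x, by omega⟩
  map_rel' := by
    intro x y hxy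
    rw [SimpleGraph.pathGraph_adj] at hxy ⊢
    simp only
    omega

theorem exists_pathTile_eq {p m : ℕ} (hp : 0 < p) (h : p ≤ m) (x : Fin m) :
    ∃ (j : Fin (m / p + 1)) (y : Fin p), pathTile h j y = x := by
  have hx := x.2
  have hdiv : (x : ℕ) / p < m / p + 1 := Nat.lt_succ_of_le (Nat.div_le_div_right hx.le)
  have hmod := Nat.div_add_mod' (x : ℕ) p
  have hlt := Nat.mod_lt (x : ℕ) hp
  refine ⟨⟨x / p, hdiv⟩, ⟨x - min (x / p * p) (m - p), by omega⟩, ?_⟩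
  ext
  simp only [pathTile, RelHom.coeFn_mk]
  omega

theorem gridCount_le_pow {p q m n : ℕ} (hp : 0 < p) (hq : 0 < q) (hm : p ≤ m) (hn : q ≤ n) :
    gridCount m n ≤ gridCount p q ^ ((m / p + 1) * (n / q + 1)) := by
  have := numIndepSets_le_pow
    (fun j : Fin (m / p + 1) × Fin (n / q + 1) => boxProdMap (pathTile hm j.1) (pathTile hn j.2))
    (by
      rintro ⟨x, y⟩
      obtain ⟨i, x', hx⟩ := exists_pathTile_eq hp hm x
      obtain ⟨j, y', hy⟩ := exists_pathTile_eq hq hn y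
      exact ⟨(i, j), (x', y'), Prod.ext hx hy⟩)
  simpa [gridCount] using this

theorem cycleGraph_adj_castSucc {n : ℕ} {x y : Fin n}
    (h : (SimpleGraph.cycleGraph (n + 1)).Adj x.castSucc y.castSucc) :
    (SimpleGraph.pathGraph n).Adj x y := by
  rw [SimpleGraph.cycleGraph_adj'] at h
  rw [SimpleGraph.pathGraph_adj]
  simp only [Fin.sub_def, Fin.val_castSucc] at h
  have hx := x.2
  have hy := y.2
  have key : ∀ a b : ℕ, a < n → b < n → (n + 1 - b + a) % (n + 1) = 1 → b + 1 = a := by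
    intro a b ha hb hab
    rcases le_or_gt b a with hle | hlt
    · rw [show n + 1 - b + a = a - b + (n + 1) by omega, Nat.add_mod_right,
        Nat.mod_eq_of_lt (by omega)] at hab
      omega
    · rw [Nat.mod_eq_of_lt (by omega)] at hab
      omega
  rcases h with h | h
  · exact Or.inr (key _ _ hx hy h)
  · exact Or.inl (key _ _ hy hx h)

theorem gridCount_le_cylinder (m n : ℕ) :
    gridCount m n ≤ numIndepSets
      ((SimpleGraph.pathGraph m).boxProd (SimpleGraph.cycleGraph (n + 1))) := by
  refine numIndepSets_le_of_reflects (fun x => (x.1, x.2.castSucc)) ?_ ?_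
  · rintro ⟨x₁, x₂⟩ ⟨y₁, y₂⟩ h
    simpa using h
  · rintro ⟨x₁, x₂⟩ ⟨y₁, y₂⟩ (⟨h, h'⟩ | ⟨h, h'⟩)
    · exact Or.inl ⟨h, Fin.castSucc_injective _ h'⟩
    · exact Or.inr ⟨cycleGraph_adj_castSucc h, h'⟩

theorem cylinder_le_gridCount (m n : ℕ) :
    numIndepSets ((SimpleGraph.pathGraph m).boxProd (SimpleGraph.cycleGraph n)) ≤
      gridCount m n :=
  numIndepSets_le_of_surjective
    (boxProdMap SimpleGraph.Hom.id (SimpleGraph.Hom.ofLE SimpleGraph.pathGraph_le_cycleGraph))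
    fun x => ⟨x, rfl⟩

theorem gridCount_le_torus (m n : ℕ) :
    gridCount m n ≤ numIndepSets (torusLattice (m + 1) (n + 1)) := by
  refine numIndepSets_le_of_reflects (fun x => (x.1.castSucc, x.2.castSucc)) ?_ ?_
  · rintro ⟨x₁, x₂⟩ ⟨y₁, y₂⟩ h
    simpa using h
  · rintro ⟨x₁, x₂⟩ ⟨y₁, y₂⟩ (⟨h, h'⟩ | ⟨h, h'⟩)
    · exact Or.inl ⟨cycleGraph_adj_castSucc h, Fin.castSucc_injective _ h'⟩
    · exact Or.inr ⟨cycleGraph_adj_castSucc h, Fin.castSucc_injective _ h'⟩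

theorem torus_le_gridCount (m n : ℕ) : numIndepSets (torusLattice m n) ≤ gridCount m n :=
  numIndepSets_le_of_surjective
    (boxProdMap (SimpleGraph.Hom.ofLE SimpleGraph.pathGraph_le_cycleGraph)
      (SimpleGraph.Hom.ofLE SimpleGraph.pathGraph_le_cycleGraph))
    fun x => ⟨x, rfl⟩

/-! ### Inequalities for powers of symmetric and of nonnegative matrices -/

/-- The sum of all entries of the `k`-th power of `M`. -/
def powSum {S : Type} [Fintype S] [DecidableEq S] (M : Matrix S S ℝ) (k : ℕ) : ℝ :=
  ∑ s, ∑ t, (M ^ k) s t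

section Matrix

variable {S : Type} [Fintype S] [DecidableEq S] {M : Matrix S S ℝ}

/-- For symmetric `M` the trace of `M ^ (2 * q)` is the squared Frobenius norm of `M ^ q`, and
that norm is submultiplicative. -/
theorem trace_pow_le (hM : M.IsSymm) (q : ℕ) {k : ℕ} (hk : 0 < k) :
    (M ^ (2 * q * k)).trace ≤ (M ^ (2 * q)).trace ^ k := by
  let := Matrix.frobeniusNormedRing (m := S) (α := ℝ)
  have key : ∀ j : ℕ, (M ^ (2 * j)).trace = ‖M ^ j‖ ^ 2 := by
    intro j
    have h1 : ∀ s t, (M ^ j) t s = (M ^ j) s t := (hM.pow j).apply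
    rw [Matrix.frobenius_norm_def, ← Real.sqrt_eq_rpow, Real.sq_sqrt (by positivity), two_mul,
      pow_add]
    simp [Matrix.trace, Matrix.mul_apply, sq, h1 _ _]
  rw [mul_assoc, key, key, ← pow_mul, mul_comm 2 k, pow_mul (‖M ^ q‖), pow_mul M]
  gcongr
  exact norm_pow_le' _ hk

/-- The Cauchy–Schwarz inequality for the vectors `M ^ i * 1` and `M ^ j * 1`. -/
theorem powSum_add_sq_le (hM : M.IsSymm) (i j : ℕ) :
    powSum M (i + j) ^ 2 ≤ powSum M (2 * i) * powSum M (2 * j) := by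
  have key : ∀ a b : ℕ,
      powSum M (a + b) = ∑ u, (∑ s, (M ^ a) u s) * (∑ t, (M ^ b) u t) := by
    intro a b
    have h1 : ∀ s u, (M ^ a) s u = (M ^ a) u s := fun s u => (hM.pow a).apply u s
    calc powSum M (a + b) = ∑ s, ∑ t, ∑ u, (M ^ a) u s * (M ^ b) u t := by
          simp only [powSum, pow_add, Matrix.mul_apply]
          exact Finset.sum_congr rfl fun s _ => Finset.sum_congr rfl fun t _ =>
            Finset.sum_congr rfl fun u _ => by rw [h1]
      _ = ∑ s, ∑ u, ∑ t, (M ^ a) u s * (M ^ b) u t :=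
          Finset.sum_congr rfl fun s _ => Finset.sum_comm
      _ = ∑ u, ∑ s, ∑ t, (M ^ a) u s * (M ^ b) u t := Finset.sum_comm
      _ = _ := by simp only [Finset.sum_mul_sum]
  rw [two_mul, two_mul, key, key, key]
  simpa [sq] using Finset.sum_mul_sq_le_sq_mul_sq Finset.univ
    (fun u => ∑ s, (M ^ i) u s) (fun u => ∑ t, (M ^ j) u t)

/-- The even moments `powSum M (2 * q)` are logarithmically convex and dominate the odd ones, so
they grow at least like the powers of `(powSum M (2 * q + 1) / powSum M (2 * q)) ^ 2`. -/
theorem powSum_pow_le (hM : M.IsSymm) (hpos : ∀ k, 0 < powSum M k) (q k : ℕ) :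
    powSum M (2 * q + 1) ^ (2 * k) * powSum M (2 * q) ≤
      powSum M (2 * q) ^ (2 * k) * powSum M (2 * q + 2 * k) := by
  set r := powSum M (2 * q + 1) ^ 2 / powSum M (2 * q) ^ 2 with hr
  -- log-convexity makes the ratios of consecutive even moments increase
  have hratio : ∀ j, r * powSum M (2 * (q + j)) ≤ powSum M (2 * (q + j + 1)) := by
    intro j
    induction j with
    | zero =>
      have h := powSum_add_sq_le hM q (q + 1)
      rw [hr, add_zero, div_mul_eq_mul_div, div_le_iff₀ (by have := hpos (2 * q); positivity)]
      rw [show q + (q + 1) = 2 * q + 1 by ring] at h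
      nlinarith [mul_le_mul_of_nonneg_right h (hpos (2 * q)).le]
    | succ j ih =>
      have h := powSum_add_sq_le hM (q + j) (q + j + 2)
      rw [show q + j + (q + j + 2) = 2 * (q + j + 1) by ring] at h
      have h0 := hpos (2 * (q + j))
      have h1 := hpos (2 * (q + j + 1))
      rw [show q + (j + 1) = q + j + 1 by ring]
      refine le_of_mul_le_mul_left ?_ h0
      calc powSum M (2 * (q + j)) * (r * powSum M (2 * (q + j + 1)))
          = r * powSum M (2 * (q + j)) * powSum M (2 * (q + j + 1)) := by ring
        _ ≤ powSum M (2 * (q + j + 1)) * powSum M (2 * (q + j + 1)) := by gcongr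
        _ ≤ _ := by rw [← sq]; exact h
  have hr0 : 0 ≤ r := by positivity
  have hpow : r ^ k * powSum M (2 * q) ≤ powSum M (2 * q + 2 * k) := by
    induction k with
    | zero => simp
    | succ k ih =>
      calc r ^ (k + 1) * powSum M (2 * q) = r * (r ^ k * powSum M (2 * q)) := by ring
        _ ≤ r * powSum M (2 * q + 2 * k) := by gcongr
        _ = r * powSum M (2 * (q + k)) := by rw [mul_add]
        _ ≤ powSum M (2 * (q + k + 1)) := hratio k
        _ = _ := by congr 1; ring
  have h0 := hpos (2 * q)
  rw [hr, div_pow, ← pow_mul, ← pow_mul, div_mul_eq_mul_div, div_le_iff₀ (by positivity)] at hpow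
  linarith

/-- The upper Collatz–Wielandt bound. -/
theorem powSum_le_of_mulVec_le (hM : ∀ s t, 0 ≤ M s t) {v : S → ℝ} (hv : ∀ s, 1 ≤ v s) {c : ℝ}
    (hc : 0 ≤ c) (h : ∀ s, ∑ t, M s t * v t ≤ c * v s) (k : ℕ) :
    powSum M k ≤ (∑ s, v s) * c ^ k := by
  have hMk : ∀ k s t, 0 ≤ (M ^ k) s t := fun k => Matrix.pow_apply_nonneg hM k
  have key : ∀ k s, ∑ t, (M ^ k) s t * v t ≤ c ^ k * v s := by
    intro k
    induction k with
    | zero => intro s; simp [Matrix.one_apply]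
    | succ k ih =>
      intro s
      calc ∑ t, (M ^ (k + 1)) s t * v t = ∑ u, (M ^ k) s u * ∑ t, M u t * v t := by
            simp only [pow_succ, Matrix.mul_apply, Finset.sum_mul, Finset.mul_sum, mul_assoc]
            exact Finset.sum_comm
        _ ≤ ∑ u, (M ^ k) s u * (c * v u) :=
            Finset.sum_le_sum fun u _ => mul_le_mul_of_nonneg_left (h u) (hMk k s u)
        _ = c * ∑ u, (M ^ k) s u * v u := by
            rw [Finset.mul_sum]; exact Finset.sum_congr rfl fun u _ => by ring
        _ ≤ c * (c ^ k * v s) := mul_le_mul_of_nonneg_left (ih s) hc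
        _ = c ^ (k + 1) * v s := by ring
  rw [powSum, Finset.sum_mul]
  refine Finset.sum_le_sum fun s _ => ?_
  calc ∑ t, (M ^ k) s t ≤ ∑ t, (M ^ k) s t * v t :=
        Finset.sum_le_sum fun t _ => le_mul_of_one_le_right (hMk k s t) (hv t)
    _ ≤ c ^ k * v s := key k s
    _ = v s * c ^ k := mul_comm _ _

/-- The lower Collatz–Wielandt bound. -/
theorem pow_le_powSum_of_le_mulVec (hM : ∀ s t, 0 ≤ M s t) {v : S → ℝ} (hv : ∀ s, 0 ≤ v s)
    (hsum : 0 < ∑ s, v s) {c : ℝ} (hc : 0 ≤ c) (h : ∀ s, c * v s ≤ ∑ t, M s t * v t) (k : ℕ) :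
    c ^ k ≤ powSum M k := by
  have hMk : ∀ k s t, 0 ≤ (M ^ k) s t := fun k => Matrix.pow_apply_nonneg hM k
  have key : ∀ k s, c ^ k * v s ≤ ∑ t, (M ^ k) s t * v t := by
    intro k
    induction k with
    | zero => intro s; simp [Matrix.one_apply]
    | succ k ih =>
      intro s
      calc c ^ (k + 1) * v s = c * (c ^ k * v s) := by ring
        _ ≤ c * ∑ u, (M ^ k) s u * v u := mul_le_mul_of_nonneg_left (ih s) hc
        _ = ∑ u, (M ^ k) s u * (c * v u) := by
            rw [Finset.mul_sum]; exact Finset.sum_congr rfl fun u _ => by ring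
        _ ≤ ∑ u, (M ^ k) s u * ∑ t, M u t * v t :=
            Finset.sum_le_sum fun u _ => mul_le_mul_of_nonneg_left (h u) (hMk k s u)
        _ = ∑ t, (M ^ (k + 1)) s t * v t := by
            simp only [pow_succ, Matrix.mul_apply, Finset.sum_mul, Finset.mul_sum, mul_assoc]
            exact Finset.sum_comm
  refine le_of_mul_le_mul_right ?_ hsum
  rw [Finset.mul_sum, powSum, Finset.sum_mul]
  refine Finset.sum_le_sum fun s _ => ?_
  calc c ^ k * v s ≤ ∑ t, (M ^ k) s t * v t := key k s
    _ ≤ ∑ t, (M ^ k) s t * ∑ u, v u :=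
        Finset.sum_le_sum fun t _ => mul_le_mul_of_nonneg_left
          (Finset.single_le_sum (fun u _ => hv u) (Finset.mem_univ t)) (hMk k s t)
    _ = (∑ t, (M ^ k) s t) * ∑ u, v u := (Finset.sum_mul _ _ _).symm

end Matrix

/-! ### Transfer matrices -/

/-- The independent sets of `G`, the states of the transfer matrix. -/
abbrev IndepState {V : Type} (G : SimpleGraph V) : Type := {s : Set V // G.IsIndepSet s}

noncomputable instance {V : Type} [Finite V] (G : SimpleGraph V) : Fintype (IndepState G) :=
  Fintype.ofFinite _

noncomputable instance {V : Type} (G : SimpleGraph V) : DecidableEq (IndepState G) :=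
  Classical.decEq _

open Classical in
/-- The transfer matrix of `G`: its entry is `1` if the two independent sets may occupy
neighbouring layers of a box product, that is, if they are disjoint, and `0` otherwise. -/
noncomputable def transfer {V : Type} (G : SimpleGraph V) :
    Matrix (IndepState G) (IndepState G) ℝ :=
  Matrix.of fun s t => if Disjoint s.1 t.1 then 1 else 0

theorem transfer_isSymm {V : Type} (G : SimpleGraph V) : (transfer G).IsSymm := by
  ext s t
  simp only [transfer, Matrix.transpose_apply, Matrix.of_apply]
  rw [disjoint_comm]

theorem transfer_nonneg {V : Type} (G : SimpleGraph V) (s t : IndepState G) :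
    0 ≤ transfer G s t := by
  simp only [transfer, Matrix.of_apply]
  split_ifs <;> norm_num

/-- An independent set of `G □ H` is a family of independent sets of `G`, one for each vertex
of `H`, with disjoint members at adjacent vertices. -/
theorem numIndepSets_boxProd {V W : Type} (G : SimpleGraph V) (H : SimpleGraph W) :
    numIndepSets (G.boxProd H) =
      Nat.card {f : W → IndepState G // ∀ w w', H.Adj w w' → Disjoint (f w).1 (f w').1} := by
  rw [numIndepSets_eq_card]
  refine Nat.card_congr
    { toFun := fun s => ⟨fun w => ⟨{v | (v, w) ∈ s.1}, ?_⟩, ?_⟩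
      invFun := fun f => ⟨{x | x.1 ∈ (f.1 x.2).1}, ?_⟩
      left_inv := fun s => rfl
      right_inv := fun f => rfl }
  · intro v hv v' hv' hne hadj
    exact s.2 hv hv' (fun h => hne (congrArg Prod.fst h)) (Or.inl ⟨hadj, rfl⟩)
  · intro w w' hadj
    rw [Set.disjoint_left]
    intro v hv hv'
    exact s.2 hv hv' (fun h => hadj.ne (congrArg Prod.snd h)) (Or.inr ⟨hadj, rfl⟩)
  · rintro ⟨v, w⟩ hx ⟨v', w'⟩ hx' - (⟨hadj, h⟩ | ⟨hadj, h⟩)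
    · obtain rfl : w = w' := h
      exact (f.1 w).2 hx hx' hadj.ne hadj
    · obtain rfl : v = v' := h
      exact Set.disjoint_left.mp (f.2 w w' hadj) hx hx'

/-- The entries of the powers of a matrix as sums over walks. -/
theorem sum_walks {S : Type} [Fintype S] [DecidableEq S] (M : Matrix S S ℝ) (k : ℕ)
    (φ : S → S → ℝ) :
    ∑ f : Fin (k + 1) → S,
        (∏ i : Fin k, M (f i.castSucc) (f i.succ)) * φ (f 0) (f (Fin.last k)) =
      ∑ s, ∑ t, (M ^ k) s t * φ s t := by
  induction k generalizing φ with
  | zero =>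
    rw [← (Equiv.funUnique (Fin 1) S).symm.sum_comp]
    simp [Matrix.one_apply, Equiv.funUnique]
  | succ k ih =>
    rw [← (Fin.consEquiv fun _ => S).sum_comp, Fintype.sum_prod_type_right]
    have h : ∀ f : Fin (k + 1) → S,
        ∑ a : S, (∏ i : Fin (k + 1), M ((Fin.consEquiv fun _ => S) (a, f) i.castSucc)
            ((Fin.consEquiv fun _ => S) (a, f) i.succ)) *
          φ ((Fin.consEquiv fun _ => S) (a, f) 0)
            ((Fin.consEquiv fun _ => S) (a, f) (Fin.last (k + 1))) =
        (∏ i : Fin k, M (f i.castSucc) (f i.succ)) *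
          ∑ a, M a (f 0) * φ a (f (Fin.last k)) := by
      intro f
      rw [Finset.mul_sum]
      refine Finset.sum_congr rfl fun a _ => ?_
      rw [Fin.prod_univ_succ]
      simp only [Fin.consEquiv, Equiv.coe_fn_mk, Fin.castSucc_zero, Fin.cons_zero, Fin.cons_succ,
        ← Fin.succ_castSucc, ← Fin.succ_last]
      ring
    rw [Finset.sum_congr rfl fun f _ => h f, ih fun s t => ∑ a, M a s * φ a t]
    simp only [pow_succ', Matrix.mul_apply, Finset.mul_sum, Finset.sum_mul]
    calc ∑ s, ∑ t, ∑ a, (M ^ k) s t * (M a s * φ a t)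
        = ∑ s, ∑ a, ∑ t, (M ^ k) s t * (M a s * φ a t) :=
          Finset.sum_congr rfl fun _ _ => Finset.sum_comm
      _ = ∑ a, ∑ s, ∑ t, (M ^ k) s t * (M a s * φ a t) := Finset.sum_comm
      _ = ∑ a, ∑ t, ∑ s, (M ^ k) s t * (M a s * φ a t) :=
          Finset.sum_congr rfl fun _ _ => Finset.sum_comm
      _ = _ := Finset.sum_congr rfl fun _ _ => Finset.sum_congr rfl fun _ _ =>
          Finset.sum_congr rfl fun _ _ => by ring

section Count

open Classical in
theorem prod_transfer {V : Type} (G : SimpleGraph V) {ι : Type} [Fintype ι]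
    (s t : ι → IndepState G) :
    ∏ i, transfer G (s i) (t i) = if ∀ i, Disjoint (s i).1 (t i).1 then 1 else 0 := by
  simp only [transfer, Matrix.of_apply]
  rw [Finset.prod_ite_zero]
  simp

variable {V : Type} [Finite V] (G : SimpleGraph V)

/-- The independent sets of `G □ P_{k+1}` are the walks with `k` steps of the transfer matrix. -/
theorem numIndepSets_boxProd_path (k : ℕ) :
    (numIndepSets (G.boxProd (SimpleGraph.pathGraph (k + 1))) : ℝ) = powSum (transfer G) k := by
  classical
  have h := sum_walks (transfer G) k fun _ _ => 1
  simp only [mul_one] at h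
  rw [powSum, ← h, numIndepSets_boxProd, Nat.card_eq_fintype_card, Fintype.card_subtype]
  have hterm : ∀ f : Fin (k + 1) → IndepState G,
      ∏ i : Fin k, transfer G (f i.castSucc) (f i.succ) =
        if ∀ i : Fin k, Disjoint (f i.castSucc).1 (f i.succ).1 then 1 else 0 :=
    fun f => by convert prod_transfer G _ _
  simp_rw [hterm, Finset.sum_boole]
  congr 3
  ext f
  constructor
  · intro hf i
    exact hf _ _ (by simp [SimpleGraph.pathGraph_adj])
  · intro hf w w' hadj
    rw [SimpleGraph.pathGraph_adj] at hadj
    rcases hadj with hadj | hadj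
    · have hi := hf ⟨w, by omega⟩
      rwa [show (⟨w, by omega⟩ : Fin k).castSucc = w from rfl,
        show (⟨w, by omega⟩ : Fin k).succ = w' from Fin.ext hadj] at hi
    · have hi := hf ⟨w', by omega⟩
      rw [show (⟨w', by omega⟩ : Fin k).castSucc = w' from rfl,
        show (⟨w', by omega⟩ : Fin k).succ = w from Fin.ext hadj] at hi
      exact hi.symm

theorem cycleGraph_adj_iff_succ {k : ℕ} (hk : 0 < k) {u v : Fin (k + 1)} :
    (SimpleGraph.cycleGraph (k + 1)).Adj u v ↔
      (u : ℕ) + 1 = v ∨ (v : ℕ) + 1 = u ∨ (u : ℕ) = 0 ∧ (v : ℕ) = k ∨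
        (v : ℕ) = 0 ∧ (u : ℕ) = k := by
  have key : ∀ a b : ℕ, a < k + 1 → b < k + 1 →
      ((k + 1 - b + a) % (k + 1) = 1 ↔ b + 1 = a ∨ a = 0 ∧ b = k) := by
    intro a b ha hb
    rcases le_or_gt b a with hle | hlt
    · rw [show k + 1 - b + a = a - b + (k + 1) by omega, Nat.add_mod_right,
        Nat.mod_eq_of_lt (by omega)]
      omega
    · rw [Nat.mod_eq_of_lt (by omega)]
      omega
  rw [SimpleGraph.cycleGraph_adj']
  simp only [Fin.sub_def]
  rw [key _ _ u.2 v.2, key _ _ v.2 u.2]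
  tauto

/-- The independent sets of `G □ C_n` are the closed walks with `n` steps of the transfer
matrix. The case `n = 1` is excluded, since `C_1` has no loop while a closed walk of one step can
only stay at the empty set. -/
theorem numIndepSets_boxProd_cycle {n : ℕ} (hn : 1 < n) :
    (numIndepSets (G.boxProd (SimpleGraph.cycleGraph n)) : ℝ) = (transfer G ^ n).trace := by
  classical
  obtain ⟨k, rfl⟩ : ∃ k, n = k + 1 := ⟨n - 1, by omega⟩
  have hk : 0 < k := by omega
  have h := sum_walks (transfer G) k fun s t => transfer G t s
  have htr : (transfer G ^ (k + 1)).trace =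
      ∑ s, ∑ t, (transfer G ^ k) s t * transfer G t s := by
    simp [Matrix.trace, pow_succ, Matrix.mul_apply]
  rw [htr, ← h, numIndepSets_boxProd, Nat.card_eq_fintype_card, Fintype.card_subtype]
  have hterm : ∀ f : Fin (k + 1) → IndepState G,
      (∏ i : Fin k, transfer G (f i.castSucc) (f i.succ)) * transfer G (f (Fin.last k)) (f 0) =
        if (∀ i : Fin k, Disjoint (f i.castSucc).1 (f i.succ).1) ∧
          Disjoint (f (Fin.last k)).1 (f 0).1 then 1 else 0 := by
    intro f
    rw [prod_transfer G, ite_and]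
    split_ifs <;> simp_all [transfer]
  simp_rw [hterm, Finset.sum_boole]
  congr 3
  ext f
  constructor
  · intro hf
    refine ⟨fun i => hf _ _ ?_, hf _ _ ?_⟩
    · rw [cycleGraph_adj_iff_succ hk]
      simp
    · rw [cycleGraph_adj_iff_succ hk]
      simp
  · rintro ⟨hf, hlast⟩ w w' hadj
    have hstep : ∀ u v : Fin (k + 1), (u : ℕ) + 1 = v → Disjoint (f u).1 (f v).1 := by
      intro u v huv
      have hi := hf ⟨u, by omega⟩
      rwa [show (⟨u, by omega⟩ : Fin k).castSucc = u from rfl,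
        show (⟨u, by omega⟩ : Fin k).succ = v from Fin.ext huv] at hi
    have hwrap : ∀ u v : Fin (k + 1), (u : ℕ) = 0 → (v : ℕ) = k → Disjoint (f v).1 (f u).1 := by
      intro u v hu hv
      rwa [show v = Fin.last k from Fin.ext hv, show u = 0 from Fin.ext hu]
    rw [cycleGraph_adj_iff_succ hk] at hadj
    rcases hadj with h | h | ⟨h, h'⟩ | ⟨h, h'⟩
    · exact hstep _ _ h
    · exact (hstep _ _ h).symm
    · exact (hwrap _ _ h h').symm
    · exact hwrap _ _ h h'

end Count

/-! ### The double limits -/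

/-- The logarithm of the common entropy constant: the infimum of `log F(p, q) / (p q)`, where
`F(p, q)` is the number of independent sets of the `p × q` grid and `p`, `q` are positive. -/
noncomputable def logEntropy : ℝ :=
  ⨅ x : ℕ × ℕ, Real.log (gridCount (x.1 + 1) (x.2 + 1)) / (((x.1 + 1 : ℕ) : ℝ) * (x.2 + 1 : ℕ))

theorem log_gridCount_nonneg (m n : ℕ) : 0 ≤ Real.log (gridCount m n) :=
  Real.log_natCast_nonneg _

theorem logEntropy_le {m n : ℕ} (hm : 0 < m) (hn : 0 < n) :
    logEntropy ≤ Real.log (gridCount m n) / ((m : ℝ) * n) := by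
  obtain ⟨m, rfl⟩ : ∃ k, m = k + 1 := ⟨m - 1, by omega⟩
  obtain ⟨n, rfl⟩ : ∃ k, n = k + 1 := ⟨n - 1, by omega⟩
  refine ciInf_le (f := fun x : ℕ × ℕ => Real.log (gridCount (x.1 + 1) (x.2 + 1)) /
    (((x.1 + 1 : ℕ) : ℝ) * (x.2 + 1 : ℕ))) ⟨0, ?_⟩ (m, n)
  rintro _ ⟨x, rfl⟩
  exact div_nonneg (log_gridCount_nonneg _ _) (by positivity)

theorem log_gridCount_div_le {p q m n : ℕ} (hp : 0 < p) (hq : 0 < q) (hm : p ≤ m) (hn : q ≤ n) :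
    Real.log (gridCount m n) / ((m : ℝ) * n) ≤
      (1 / p + 1 / m) * (1 / q + 1 / n) * Real.log (gridCount p q) := by
  have hm0 : (0 : ℝ) < m := by exact_mod_cast hp.trans_le hm
  have hn0 : (0 : ℝ) < n := by exact_mod_cast hq.trans_le hn
  have hL := log_gridCount_nonneg p q
  have h1 : Real.log (gridCount m n) ≤
      ((m / p : ℕ) + 1) * ((n / q : ℕ) + 1) * Real.log (gridCount p q) := by
    have h := gridCount_le_pow hp hq hm hn
    have h' : Real.log (gridCount m n) ≤
        Real.log ((gridCount p q : ℝ) ^ ((m / p + 1) * (n / q + 1))) :=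
      Real.log_le_log (by exact_mod_cast gridCount_pos m n) (by exact_mod_cast h)
    rw [Real.log_pow] at h'
    exact_mod_cast h'
  have h2 : ((m / p : ℕ) : ℝ) ≤ m / p := Nat.cast_div_le
  have h3 : ((n / q : ℕ) : ℝ) ≤ n / q := Nat.cast_div_le
  rw [div_le_iff₀ (by positivity)]
  calc Real.log (gridCount m n)
      ≤ ((m : ℝ) / p + 1) * ((n : ℝ) / q + 1) * Real.log (gridCount p q) := by
        refine h1.trans ?_
        gcongr
    _ = _ := by
        have hp0 : (0 : ℝ) < p := by exact_mod_cast hp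
        have hq0 : (0 : ℝ) < q := by exact_mod_cast hq
        field_simp

/-- The two-dimensional form of Fekete's lemma for the grid. -/
theorem tendsto_log_gridCount :
    Tendsto (fun x : ℕ × ℕ => Real.log (gridCount x.1 x.2) / ((x.1 : ℝ) * x.2))
      (atTop ×ˢ atTop) (𝓝 logEntropy) := by
  have hge : ∀ a b : ℕ, ∀ᶠ x : ℕ × ℕ in atTop ×ˢ atTop, a ≤ x.1 ∧ b ≤ x.2 := fun a b =>
    (eventually_ge_atTop a).prod_mk (eventually_ge_atTop b)
  rw [tendsto_order]
  constructor
  · intro a ha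
    filter_upwards [hge 1 1] with x hx
    exact ha.trans_le (logEntropy_le hx.1 hx.2)
  · intro a ha
    obtain ⟨⟨p, q⟩, hpq⟩ := exists_lt_of_ciInf_lt ha
    have hlim : Tendsto (fun x : ℕ × ℕ => (1 / ((p + 1 : ℕ) : ℝ) + 1 / (x.1 : ℝ)) *
        (1 / ((q + 1 : ℕ) : ℝ) + 1 / (x.2 : ℝ)) * Real.log (gridCount (p + 1) (q + 1)))
        (atTop ×ˢ atTop) (𝓝 ((1 / ((p + 1 : ℕ) : ℝ) + 0) *
        (1 / ((q + 1 : ℕ) : ℝ) + 0) * Real.log (gridCount (p + 1) (q + 1)))) :=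
      ((tendsto_const_nhds.add (tendsto_one_div_atTop_nhds_zero_nat.comp tendsto_fst)).mul
        (tendsto_const_nhds.add
          (tendsto_one_div_atTop_nhds_zero_nat.comp tendsto_snd))).mul_const _
    have hlt : (1 / ((p + 1 : ℕ) : ℝ) + 0) * (1 / ((q + 1 : ℕ) : ℝ) + 0) *
        Real.log (gridCount (p + 1) (q + 1)) < a := by
      refine lt_of_eq_of_lt ?_ hpq
      field_simp
      ring
    filter_upwards [hge (p + 1) (q + 1), hlim.eventually_lt_const hlt] with x hx hx'
    exact (log_gridCount_div_le p.succ_pos q.succ_pos hx.1 hx.2).trans_lt hx'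

/-- Counts squeezed between those of two grids with asymptotically as many vertices have the same
limit. -/
theorem tendsto_log_of_gridCount_le {α : Type} {l : Filter α} {a b a' b' f : α → ℕ}
    {N : α → ℝ} (ha : Tendsto a l atTop) (hb : Tendsto b l atTop) (ha' : Tendsto a' l atTop)
    (hb' : Tendsto b' l atTop) (h : ∀ᶠ x in l, gridCount (a x) (b x) ≤ f x)
    (h' : ∀ᶠ x in l, f x ≤ gridCount (a' x) (b' x)) (hN : ∀ x, 0 ≤ N x)
    (hr : Tendsto (fun x => ((a x : ℝ) * b x) / N x) l (𝓝 1))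
    (hr' : Tendsto (fun x => ((a' x : ℝ) * b' x) / N x) l (𝓝 1)) :
    Tendsto (fun x => Real.log (f x) / N x) l (𝓝 logEntropy) := by
  have hL := (tendsto_log_gridCount.comp (ha.prodMk hb)).mul hr
  have hU := (tendsto_log_gridCount.comp (ha'.prodMk hb')).mul hr'
  rw [mul_one] at hL hU
  refine tendsto_of_tendsto_of_tendsto_of_le_of_le' hL hU ?_ ?_
  · filter_upwards [h, ha.eventually_ge_atTop 1, hb.eventually_ge_atTop 1] with x hx hax hbx
    have hax' : (0 : ℝ) < a x := by exact_mod_cast hax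
    have hbx' : (0 : ℝ) < b x := by exact_mod_cast hbx
    simp only [Function.comp]
    rw [div_mul_div_cancel₀ (by positivity)]
    have := gridCount_pos (a x) (b x)
    have hNx := hN x
    gcongr
  · filter_upwards [h, h', ha'.eventually_ge_atTop 1, hb'.eventually_ge_atTop 1]
      with x hx hx' hax hbx
    have hax' : (0 : ℝ) < a' x := by exact_mod_cast hax
    have hbx' : (0 : ℝ) < b' x := by exact_mod_cast hbx
    simp only [Function.comp]
    rw [div_mul_div_cancel₀ (by positivity)]
    have : 0 < f x := (gridCount_pos (a x) (b x)).trans_le hx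
    have hNx := hN x
    gcongr

theorem tendsto_pred_div_self : Tendsto (fun n : ℕ => ((n - 1 : ℕ) : ℝ) / n) atTop (𝓝 1) := by
  have h : Tendsto (fun n : ℕ => 1 - 1 / (n : ℝ)) atTop (𝓝 (1 - 0)) :=
    tendsto_const_nhds.sub tendsto_one_div_atTop_nhds_zero_nat
  rw [sub_zero] at h
  refine h.congr' ?_
  filter_upwards [eventually_ge_atTop 1] with n hn
  have : (n : ℝ) ≠ 0 := by positivity
  rw [Nat.cast_sub hn]
  field_simp
  simp

theorem isEntropyConstant_exp {V : ℕ → ℕ → Type} [∀ m n, Finite (V m n)]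
    {G : ∀ m n : ℕ, SimpleGraph (V m n)} {g : ℝ}
    (h : Tendsto (fun p : ℕ × ℕ => Real.log (numIndepSets (G p.1 p.2)) /
      (Nat.card (V p.1 p.2) : ℝ)) (atTop ×ˢ atTop) (𝓝 g)) :
    IsEntropyConstant G (Real.exp g) := by
  refine ((Real.continuous_exp.tendsto g).comp h).congr fun p => ?_
  have hpos : (0 : ℝ) < numIndepSets (G p.1 p.2) := by exact_mod_cast numIndepSets_pos _
  rw [Real.rpow_def_of_pos hpos, Function.comp, mul_one_div]

theorem tendsto_fst_add_one : Tendsto (fun x : ℕ × ℕ => x.1 + 1) (atTop ×ˢ atTop) atTop :=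
  (tendsto_add_atTop_nat 1).comp tendsto_fst

theorem tendsto_snd_add_one : Tendsto (fun x : ℕ × ℕ => x.2 + 1) (atTop ×ˢ atTop) atTop :=
  (tendsto_add_atTop_nat 1).comp tendsto_snd

theorem tendsto_fst_sub_one : Tendsto (fun x : ℕ × ℕ => x.1 - 1) (atTop ×ˢ atTop) atTop :=
  (tendsto_sub_atTop_nat 1).comp tendsto_fst

theorem tendsto_snd_sub_one : Tendsto (fun x : ℕ × ℕ => x.2 - 1) (atTop ×ˢ atTop) atTop :=
  (tendsto_sub_atTop_nat 1).comp tendsto_snd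

theorem isEntropyConstant_plane : IsEntropyConstant planeLattice (Real.exp logEntropy) := by
  refine isEntropyConstant_exp ?_
  have h := tendsto_log_gridCount.comp (tendsto_fst_add_one.prodMk tendsto_snd_add_one)
  refine h.congr fun x => ?_
  simp [gridCount, planeLattice]

theorem tendsto_log_cylinder :
    Tendsto (fun x : ℕ × ℕ => Real.log (numIndepSets
      ((SimpleGraph.pathGraph x.1).boxProd (SimpleGraph.cycleGraph x.2))) / ((x.1 : ℝ) * x.2))
      (atTop ×ˢ atTop) (𝓝 logEntropy) := by
  have hge : ∀ᶠ x : ℕ × ℕ in atTop ×ˢ atTop, 1 ≤ x.1 ∧ 1 ≤ x.2 :=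
    (eventually_ge_atTop 1).prod_mk (eventually_ge_atTop 1)
  refine tendsto_log_of_gridCount_le (a := fun x => x.1) (b := fun x => x.2 - 1)
    (a' := fun x => x.1) (b' := fun x => x.2) tendsto_fst
    tendsto_snd_sub_one tendsto_fst tendsto_snd ?_
    (Eventually.of_forall fun x => cylinder_le_gridCount _ _) (fun x => by positivity) ?_ ?_
  · filter_upwards [hge] with x hx
    have := gridCount_le_cylinder x.1 (x.2 - 1)
    rwa [Nat.sub_add_cancel hx.2] at this
  · refine (tendsto_pred_div_self.comp tendsto_snd).congr' ?_
    filter_upwards [hge] with x hx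
    have : (0 : ℝ) < x.1 := by exact_mod_cast hx.1
    simp only [Function.comp]
    rw [mul_div_mul_left _ _ this.ne']
  · refine tendsto_const_nhds.congr' ?_
    filter_upwards [hge] with x hx
    have h1 : (0 : ℝ) < x.1 := by exact_mod_cast hx.1
    have h2 : (0 : ℝ) < x.2 := by exact_mod_cast hx.2
    rw [div_self (by positivity)]

theorem isEntropyConstant_cylinder :
    IsEntropyConstant cylinderLattice (Real.exp logEntropy) := by
  refine isEntropyConstant_exp ?_
  have h := tendsto_log_cylinder.comp (tendsto_fst_add_one.prodMk tendsto_snd)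
  refine h.congr fun x => ?_
  simp [cylinderLattice]

theorem isEntropyConstant_torus : IsEntropyConstant torusLattice (Real.exp logEntropy) := by
  refine isEntropyConstant_exp ?_
  have hge : ∀ᶠ x : ℕ × ℕ in atTop ×ˢ atTop, 1 ≤ x.1 ∧ 1 ≤ x.2 :=
    (eventually_ge_atTop 1).prod_mk (eventually_ge_atTop 1)
  simp only [Nat.card_prod, Nat.card_fin, Nat.cast_mul]
  refine tendsto_log_of_gridCount_le (a := fun x => x.1 - 1) (b := fun x => x.2 - 1)
    (a' := fun x => x.1) (b' := fun x => x.2) tendsto_fst_sub_one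
    tendsto_snd_sub_one tendsto_fst tendsto_snd ?_
    (Eventually.of_forall fun x => torus_le_gridCount _ _) (fun x => by positivity) ?_ ?_
  · filter_upwards [hge] with x hx
    have := gridCount_le_torus (x.1 - 1) (x.2 - 1)
    rwa [Nat.sub_add_cancel hx.1, Nat.sub_add_cancel hx.2] at this
  · have h := (tendsto_pred_div_self.comp (tendsto_fst (f := atTop) (g := atTop (α := ℕ)))).mul
      (tendsto_pred_div_self.comp (tendsto_snd (f := atTop (α := ℕ)) (g := atTop)))
    rw [mul_one] at h
    refine h.congr fun x => ?_
    simp only [Function.comp]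
    rw [div_mul_div_comm]
  · refine tendsto_const_nhds.congr' ?_
    filter_upwards [hge] with x hx
    have h1 : (0 : ℝ) < x.1 := by exact_mod_cast hx.1
    have h2 : (0 : ℝ) < x.2 := by exact_mod_cast hx.2
    rw [div_self (by positivity)]

/-! ### Bounds on the entropy from strips and cylinders of fixed width -/

theorem gridCount_succ_right (m j : ℕ) :
    (gridCount m (j + 1) : ℝ) = powSum (transfer (SimpleGraph.pathGraph m)) j :=
  numIndepSets_boxProd_path _ _

theorem gridCount_pow_le (m q k : ℕ) :
    (gridCount m (2 * q + 2) : ℝ) ^ (2 * k) * gridCount m (2 * q + 1) ≤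
      (gridCount m (2 * q + 1) : ℝ) ^ (2 * k) * gridCount m (2 * q + 2 * k + 1) := by
  simp only [gridCount_succ_right]
  refine powSum_pow_le (transfer_isSymm _) (fun j => ?_) q k
  rw [← gridCount_succ_right]
  exact_mod_cast gridCount_pos _ _

/-- If the grids of width `2 * q + 2` grow at least like `c₁ ^ m` and those of width `2 * q + 1`
at most like `c₂ ^ m`, then the entropy is at least `log (c₁ / c₂)`. -/
theorem log_div_le_logEntropy {q : ℕ} {C₁ C₂ c₁ c₂ : ℝ} (hC₁ : 0 < C₁) (hC₂ : 0 < C₂)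
    (hc₁ : 0 < c₁) (hc₂ : 0 < c₂) (h₁ : ∀ m, C₁ * c₁ ^ m ≤ gridCount (m + 1) (2 * q + 2))
    (h₂ : ∀ m, (gridCount (m + 1) (2 * q + 1) : ℝ) ≤ C₂ * c₂ ^ m) :
    Real.log (c₁ / c₂) ≤ logEntropy := by
  have hmul : Tendsto (fun k : ℕ => 2 * q + 2 * k + 1) atTop atTop :=
    tendsto_atTop_mono (fun k => by simp only [id]; omega) tendsto_id
  -- the double limit may be evaluated along a sequence on which both indices tend to infinity
  have hlim := tendsto_log_gridCount.comp ((tendsto_add_atTop_nat 1).prodMk hmul)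
  have hbound : ∀ k : ℕ, 2 * k * (Real.log (C₁ / C₂) + k * Real.log (c₁ / c₂)) ≤
      Real.log (gridCount (k + 1) (2 * q + 2 * k + 1)) := by
    intro k
    have hA := h₁ k
    have hB := h₂ k
    set A : ℝ := (gridCount (k + 1) (2 * q + 2) : ℝ) with hA_def
    set B : ℝ := (gridCount (k + 1) (2 * q + 1) : ℝ) with hB_def
    set D : ℝ := (gridCount (k + 1) (2 * q + 2 * k + 1) : ℝ) with hD_def
    have hA0 : 0 < A := Nat.cast_pos.mpr (gridCount_pos _ _)
    have hB0 : 1 ≤ B := Nat.one_le_cast.mpr (gridCount_pos _ _)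
    have hD0 : 0 < D := Nat.cast_pos.mpr (gridCount_pos _ _)
    have hle : A ^ (2 * k) ≤ B ^ (2 * k) * D :=
      (le_mul_of_one_le_right (by positivity) hB0).trans (gridCount_pow_le (k + 1) q k)
    have hlog := Real.log_le_log (by positivity) hle
    rw [Real.log_mul (by positivity) (by positivity), Real.log_pow, Real.log_pow] at hlog
    have hlogA := Real.log_le_log (by positivity) hA
    have hlogB := Real.log_le_log (by positivity) hB
    rw [Real.log_mul (by positivity) (by positivity), Real.log_pow] at hlogA hlogB
    rw [Real.log_div hC₁.ne' hC₂.ne', Real.log_div hc₁.ne' hc₂.ne']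
    push_cast at hlog
    have hk : (0 : ℝ) ≤ 2 * k := by positivity
    nlinarith [mul_le_mul_of_nonneg_left hlogA hk, mul_le_mul_of_nonneg_left hlogB hk]
  set a := Real.log (C₁ / C₂)
  set b := Real.log (c₁ / c₂)
  have hinv : Tendsto (fun k : ℕ => 1 / ((k : ℝ) + 1)) atTop (𝓝 0) :=
    tendsto_one_div_add_atTop_nhds_zero_nat
  have hinv' : Tendsto (fun k : ℕ => 1 / ((2 * q + 2 * k + 1 : ℕ) : ℝ)) atTop (𝓝 0) :=
    tendsto_one_div_atTop_nhds_zero_nat.comp hmul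
  have hlow : Tendsto (fun k : ℕ => (1 - (2 * q + 1) * (1 / ((2 * q + 2 * k + 1 : ℕ) : ℝ))) *
      (b + (a - b) * (1 / ((k : ℝ) + 1)))) atTop
      (𝓝 ((1 - (2 * q + 1) * 0) * (b + (a - b) * 0))) :=
    (tendsto_const_nhds.sub (hinv'.const_mul _)).mul
      (tendsto_const_nhds.add (hinv.const_mul _))
  rw [mul_zero, mul_zero, sub_zero, add_zero, one_mul] at hlow
  refine le_of_tendsto_of_tendsto' hlow hlim fun k => ?_
  simp only [Function.comp]
  rw [le_div_iff₀ (by positivity)]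
  refine le_of_eq_of_le ?_ (hbound k)
  push_cast
  field_simp
  ring

/-- If the cylinders of even circumference `2 * q` grow at most like `c ^ m`, then the entropy
is at most `log c / (2 * q)`. -/
theorem logEntropy_le_log_div {q : ℕ} (hq : 0 < q) {C c : ℝ} (hC : 0 < C) (hc : 0 < c)
    (h : ∀ m, (numIndepSets ((SimpleGraph.pathGraph (m + 1)).boxProd
      (SimpleGraph.cycleGraph (2 * q))) : ℝ) ≤ C * c ^ m) :
    logEntropy ≤ Real.log c / (2 * q) := by
  have hmul : Tendsto (fun k : ℕ => 2 * q * (k + 1)) atTop atTop :=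
    tendsto_atTop_mono (fun k => by simp only [id]; nlinarith) tendsto_id
  -- a single sequence on which both indices tend to infinity suffices
  have hlim := tendsto_log_cylinder.comp ((tendsto_add_atTop_nat 1).prodMk hmul)
  have hinv : Tendsto (fun k : ℕ => 1 / ((k : ℝ) + 1)) atTop (𝓝 0) :=
    tendsto_one_div_add_atTop_nhds_zero_nat
  have hup : Tendsto (fun k : ℕ =>
      (Real.log c + (Real.log C - Real.log c) * (1 / ((k : ℝ) + 1))) / (2 * q)) atTop
      (𝓝 ((Real.log c + (Real.log C - Real.log c) * 0) / (2 * q))) :=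
    (tendsto_const_nhds.add (hinv.const_mul _)).div_const _
  rw [mul_zero, add_zero] at hup
  refine le_of_tendsto_of_tendsto' hlim hup fun k => ?_
  simp only [Function.comp]
  have hle : (numIndepSets ((SimpleGraph.pathGraph (k + 1)).boxProd
      (SimpleGraph.cycleGraph (2 * q * (k + 1)))) : ℝ) ≤ (C * c ^ k) ^ (k + 1) := by
    refine le_trans ?_ (pow_le_pow_left₀ (by positivity) (h k) (k + 1))
    rw [numIndepSets_boxProd_cycle _ (by nlinarith), numIndepSets_boxProd_cycle _ (by omega)]
    exact trace_pow_le (transfer_isSymm _) q k.succ_pos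
  have hlog := Real.log_le_log (by exact_mod_cast numIndepSets_pos _) hle
  rw [Real.log_pow, Real.log_mul (by positivity) (by positivity), Real.log_pow] at hlog
  have hq' : (0 : ℝ) < q := by exact_mod_cast hq
  rw [div_le_iff₀ (by positivity)]
  refine hlog.trans (le_of_eq ?_)
  push_cast
  field_simp
  ring

/-! ### Checking Collatz–Wielandt bounds on tables of weights -/

/-- The set of positions below `k` at which the binary expansion of `b` has a `1`. -/
def maskSet (k b : ℕ) : Set (Fin k) := {i | b.testBit i}

theorem mem_maskSet {k b : ℕ} {i : Fin k} : i ∈ maskSet k b ↔ b.testBit i := Iff.rfl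

theorem eq_of_testBit_eq_of_lt {k a b : ℕ} (ha : a < 2 ^ k) (hb : b < 2 ^ k)
    (h : ∀ i < k, a.testBit i = b.testBit i) : a = b := by
  refine Nat.eq_of_testBit_eq fun i => ?_
  rcases lt_or_ge i k with hi | hi
  · exact h i hi
  · have hpow : 2 ^ k ≤ 2 ^ i := Nat.pow_le_pow_right two_pos hi
    rw [Nat.testBit_lt_two_pow (ha.trans_le hpow), Nat.testBit_lt_two_pow (hb.trans_le hpow)]

theorem maskSet_injOn {k a b : ℕ} (ha : a < 2 ^ k) (hb : b < 2 ^ k)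
    (h : maskSet k a = maskSet k b) : a = b :=
  eq_of_testBit_eq_of_lt ha hb fun i hi =>
    Bool.eq_iff_iff.mpr (Set.ext_iff.mp h ⟨i, hi⟩)

theorem exists_maskSet_eq {k : ℕ} (s : Set (Fin k)) : ∃ b < 2 ^ k, maskSet k b = s := by
  classical
  refine ⟨Nat.ofBits fun i : Fin k => decide (i ∈ s), Nat.ofBits_lt_two_pow _, ?_⟩
  ext i
  simp [maskSet]

theorem disjoint_maskSet_iff {k a b : ℕ} (ha : a < 2 ^ k) :
    Disjoint (maskSet k a) (maskSet k b) ↔ a &&& b = 0 := by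
  rw [Set.disjoint_left]
  constructor
  · intro h
    refine eq_of_testBit_eq_of_lt (Nat.and_le_left.trans_lt ha) (by positivity) fun i hi => ?_
    have := h (a := ⟨i, hi⟩)
    simp only [mem_maskSet] at this
    simp only [Nat.testBit_and, Nat.zero_testBit]
    grind
  · intro h i hia hib
    have := congrArg (fun n => n.testBit i) h
    simp only [mem_maskSet] at hia hib
    simp [Nat.testBit_and, hia, hib] at this

/-- Whether the set coded by `b` contains no pair from the list `E`, as a Boolean that evaluates
quickly. -/
def maskIndep {k : ℕ} (E : List (Fin k × Fin k)) (b : ℕ) : Bool :=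
  E.all fun e => !(b.testBit e.1 && b.testBit e.2)

theorem maskIndep_iff {k : ℕ} {H : SimpleGraph (Fin k)} {E : List (Fin k × Fin k)}
    (hE : ∀ i j, H.Adj i j ↔ (i, j) ∈ E ∨ (j, i) ∈ E) (b : ℕ) :
    maskIndep E b ↔ H.IsIndepSet (maskSet k b) := by
  simp only [maskIndep, List.all_eq_true, Bool.not_eq_true', Bool.and_eq_false_iff]
  constructor
  · intro h i hi j hj _ hadj
    simp only [mem_maskSet] at hi hj
    rcases (hE i j).mp hadj with hmem | hmem
    · have := h _ hmem
      simp_all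
    · have := h _ hmem
      simp_all
  · rintro h ⟨i, j⟩ hmem
    have hadj := (hE i j).mpr (Or.inl hmem)
    by_contra! hij
    exact h (Bool.eq_true_of_not_eq_false hij.1) (Bool.eq_true_of_not_eq_false hij.2) hadj.ne hadj

/-- The total weight in a table of pairs (code of a set, weight) of the sets disjoint from the
one coded by `b`. -/
def disjointWeight (T : List (ℕ × ℕ)) (b : ℕ) : ℕ :=
  (T.map fun p => if b &&& p.1 = 0 then p.2 else 0).sum

/-- A table listing the codes of all independent sets of `H` gives a vector on which the transfer
matrix acts by `disjointWeight`. -/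
theorem exists_vector_of_table {k : ℕ} {H : SimpleGraph (Fin k)} {E : List (Fin k × Fin k)}
    (hE : ∀ i j, H.Adj i j ↔ (i, j) ∈ E ∨ (j, i) ∈ E) {T : List (ℕ × ℕ)}
    (hT : T.map Prod.fst = (List.range (2 ^ k)).filter (maskIndep E)) :
    ∃ v : IndepState H → ℝ, ∀ s, ∃ p ∈ T, v s = p.2 ∧
      ∑ t, transfer H s t * v t = disjointWeight T p.1 := by
  classical
  have hmem : ∀ b, b ∈ T.map Prod.fst ↔ b < 2 ^ k ∧ H.IsIndepSet (maskSet k b) := by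
    intro b
    rw [hT, List.mem_filter, List.mem_range, maskIndep_iff hE]
  have hcode : ∀ i : Fin T.length, T[i.1].1 ∈ T.map Prod.fst := fun i =>
    List.mem_map_of_mem (List.getElem_mem i.2)
  let e : Fin T.length → IndepState H := fun i =>
    ⟨maskSet k T[i.1].1, ((hmem _).mp (hcode i)).2⟩
  have he : Function.Bijective e := by
    constructor
    · intro i j hij
      have hbit := maskSet_injOn ((hmem _).mp (hcode i)).1 ((hmem _).mp (hcode j)).1
        (congrArg Subtype.val hij)
      have hnodup : (T.map Prod.fst).Nodup := hT ▸ List.nodup_range.filter _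
      refine Fin.ext ((hnodup.getElem_inj_iff (hi := by simp) (hj := by simp)).mp ?_)
      simpa using hbit
    · rintro ⟨s, hs⟩
      obtain ⟨b, hb, rfl⟩ := exists_maskSet_eq s
      obtain ⟨i, hi, hib⟩ := List.getElem_of_mem ((hmem b).mpr ⟨hb, hs⟩)
      refine ⟨⟨i, by simpa using hi⟩, Subtype.ext ?_⟩
      simp only [e]
      rw [← hib, List.getElem_map]
  let e' := Equiv.ofBijective e he
  refine ⟨fun s => T[(e'.symm s).1].2, fun s => ?_⟩
  obtain ⟨i, rfl⟩ := e'.surjective s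
  refine ⟨T[i.1], List.getElem_mem i.2, by simp, ?_⟩
  rw [← e'.sum_comp, disjointWeight, ← Fin.sum_univ_fun_getElem, Nat.cast_sum]
  refine Finset.sum_congr rfl fun j _ => ?_
  simp only [Equiv.symm_apply_apply]
  have hdisj : Disjoint (e' i).1 (e' j).1 ↔ T[i.1].1 &&& T[j.1].1 = 0 :=
    disjoint_maskSet_iff ((hmem _).mp (hcode i)).1
  simp [transfer, hdisj]

theorem exists_powSum_le_of_table {k : ℕ} {H : SimpleGraph (Fin k)} {E : List (Fin k × Fin k)}
    (hE : ∀ i j, H.Adj i j ↔ (i, j) ∈ E ∨ (j, i) ∈ E) {T : List (ℕ × ℕ)}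
    (hT : T.map Prod.fst = (List.range (2 ^ k)).filter (maskIndep E)) {a d : ℕ} (hd : 0 < d)
    (h : ∀ p ∈ T, 1 ≤ p.2 ∧ d * disjointWeight T p.1 ≤ a * p.2) :
    ∃ C : ℝ, 0 < C ∧ ∀ m, powSum (transfer H) m ≤ C * ((a : ℝ) / d) ^ m := by
  obtain ⟨v, hv⟩ := exists_vector_of_table hE hT
  have hv1 : ∀ s, 1 ≤ v s := fun s => by
    obtain ⟨p, hp, hvp, -⟩ := hv s
    rw [hvp]
    exact_mod_cast (h p hp).1
  have : Nonempty (IndepState H) := ⟨⟨∅, by simp [SimpleGraph.IsIndepSet]⟩⟩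
  refine ⟨∑ s, v s, Finset.sum_pos (fun s _ => one_pos.trans_le (hv1 s)) Finset.univ_nonempty,
    powSum_le_of_mulVec_le (transfer_nonneg H) hv1 (by positivity) fun s => ?_⟩
  obtain ⟨p, hp, hvp, hsum⟩ := hv s
  have hd' : (0 : ℝ) < d := by exact_mod_cast hd
  rw [hsum, hvp, div_mul_eq_mul_div, le_div_iff₀ hd', mul_comm]
  exact_mod_cast (h p hp).2

theorem pow_le_powSum_of_table {k : ℕ} {H : SimpleGraph (Fin k)} {E : List (Fin k × Fin k)}
    (hE : ∀ i j, H.Adj i j ↔ (i, j) ∈ E ∨ (j, i) ∈ E) {T : List (ℕ × ℕ)}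
    (hT : T.map Prod.fst = (List.range (2 ^ k)).filter (maskIndep E)) {a d : ℕ} (hd : 0 < d)
    (h : ∀ p ∈ T, 1 ≤ p.2 ∧ a * p.2 ≤ d * disjointWeight T p.1) (m : ℕ) :
    ((a : ℝ) / d) ^ m ≤ powSum (transfer H) m := by
  obtain ⟨v, hv⟩ := exists_vector_of_table hE hT
  have hv1 : ∀ s, 1 ≤ v s := fun s => by
    obtain ⟨p, hp, hvp, -⟩ := hv s
    rw [hvp]
    exact_mod_cast (h p hp).1
  have : Nonempty (IndepState H) := ⟨⟨∅, by simp [SimpleGraph.IsIndepSet]⟩⟩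
  refine pow_le_powSum_of_le_mulVec (transfer_nonneg H) (fun s => zero_le_one.trans (hv1 s))
    (Finset.sum_pos (fun s _ => one_pos.trans_le (hv1 s)) Finset.univ_nonempty) (by positivity)
    (fun s => ?_) m
  obtain ⟨p, hp, hvp, hsum⟩ := hv s
  have hd' : (0 : ℝ) < d := by exact_mod_cast hd
  rw [hsum, hvp, div_mul_eq_mul_div, div_le_iff₀ hd', mul_comm (disjointWeight T p.1 : ℝ)]
  exact_mod_cast (h p hp).2

/-! ### The numerical bounds -/

/-- The edges of the path on `7` vertices. -/
def pathEdges7 : List (Fin 7 × Fin 7) :=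
  [(0, 1), (1, 2), (2, 3), (3, 4), (4, 5), (5, 6)]

/-- The edges of the path on `8` vertices. -/
def pathEdges8 : List (Fin 8 × Fin 8) :=
  [(0, 1), (1, 2), (2, 3), (3, 4), (4, 5), (5, 6), (6, 7)]

/-- The edges of the cycle on `6` vertices. -/
def cycleEdges6 : List (Fin 6 × Fin 6) :=
  [(0, 1), (1, 2), (2, 3), (3, 4), (4, 5), (5, 0)]

/-- The independent sets of the path on `7` vertices, in binary, with a rounded dominant
eigenvector of the transfer matrix (eigenvalue `18.5324073…`), scaled to have least entry
`10 ^ 7`. -/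
def pathTable7 : List (ℕ × ℕ) :=
  [(0, 33370491), (1, 22873626), (2, 25586835), (4, 24696481), (5, 17838843), (8, 25117505),
   (9, 16866143), (10, 19996892), (16, 24696481), (17, 17071435), (18, 18644893),
   (20, 19082270), (21, 13811588), (32, 25586835), (33, 17483218), (34, 19727841),
   (36, 18644893), (37, 13454504), (40, 19996892), (41, 13414915), (42, 15940784),
   (64, 22873626), (65, 15707031), (66, 17483218), (68, 17071435), (69, 12338680),
   (72, 16866143), (73, 11333499), (74, 13414915), (80, 17838843), (81, 12338680),
   (82, 13454504), (84, 13811588), (85, 10000000)]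

/-- The independent sets of the path on `8` vertices, in binary, with a rounded dominant
eigenvector of the transfer matrix (eigenvalue `27.8550990…`), scaled to have least entry
`10 ^ 7`. -/
def pathTable8 : List (ℕ × ℕ) :=
  [(0, 35561861), (1, 24385791), (2, 27247519), (4, 26368976), (5, 19049642), (8, 26642886),
   (9, 17893298), (10, 21206757), (16, 26642886), (17, 18419515), (18, 20109841),
   (20, 20595717), (21, 14908169), (32, 26368976), (33, 18019351), (34, 20327922),
   (36, 19221415), (37, 13871231), (40, 20595717), (41, 13817524), (42, 16416802),
   (64, 27247519), (65, 18708921), (66, 20829453), (68, 20327922), (69, 14691911),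
   (72, 20109841), (73, 13512621), (74, 15995739), (80, 21206757), (81, 14667582),
   (82, 15995739), (84, 16416802), (85, 11886010), (128, 24385791), (129, 16709222),
   (130, 18708921), (132, 18019351), (133, 13013998), (136, 18419515), (137, 12366472),
   (138, 14667582), (144, 17893298), (145, 12366472), (146, 13512621), (148, 13817524),
   (149, 10000000), (160, 19049642), (161, 13013998), (162, 14691911), (164, 13871231),
   (165, 10008824), (168, 14908169), (169, 10000000), (170, 11886010)]

/-- The independent sets of the cycle on `6` vertices, in binary, with a rounded dominant
eigenvector of the transfer matrix (eigenvalue `11.5517095…`), scaled to have least entry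
`10 ^ 7`. -/
def cycleTable6 : List (ℕ × ℕ) :=
  [(0, 21132569), (1, 15775237), (2, 15775237), (4, 15775237), (5, 12352938), (8, 15775237),
   (9, 11405225), (10, 12352938), (16, 15775237), (17, 12352938), (18, 11405225),
   (20, 12352938), (21, 10000000), (32, 15775237), (34, 12352938), (36, 11405225),
   (40, 12352938), (42, 10000000)]

theorem exists_gridCount_seven_le :
    ∃ C : ℝ, 0 < C ∧ ∀ m, (gridCount (m + 1) 7 : ℝ) ≤ C * (18532408 / 1000000) ^ m := by
  obtain ⟨C, hC, h⟩ := exists_powSum_le_of_table (H := SimpleGraph.pathGraph 7)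
    (E := pathEdges7) (T := pathTable7) (a := 18532408) (d := 1000000)
    (by simp only [SimpleGraph.pathGraph_adj]; decide +kernel) (by decide +kernel) (by norm_num)
    (by decide +kernel)
  refine ⟨C, hC, fun m => ?_⟩
  rw [gridCount_comm, gridCount_succ_right]
  simpa using h m

theorem pow_le_gridCount_eight (m : ℕ) :
    (27855098 / 1000000 : ℝ) ^ m ≤ gridCount (m + 1) 8 := by
  have h := pow_le_powSum_of_table (H := SimpleGraph.pathGraph 8)
    (E := pathEdges8) (T := pathTable8) (a := 27855098) (d := 1000000)
    (by simp only [SimpleGraph.pathGraph_adj]; decide +kernel) (by decide +kernel) (by norm_num)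
    (by decide +kernel) m
  rw [gridCount_comm, gridCount_succ_right]
  simpa using h

theorem exists_cylinder_six_le :
    ∃ C : ℝ, 0 < C ∧ ∀ m, (numIndepSets ((SimpleGraph.pathGraph (m + 1)).boxProd
      (SimpleGraph.cycleGraph 6)) : ℝ) ≤ C * (1155171 / 100000) ^ m := by
  obtain ⟨C, hC, h⟩ := exists_powSum_le_of_table (H := SimpleGraph.cycleGraph 6)
    (E := cycleEdges6) (T := cycleTable6) (a := 1155171) (d := 100000)
    (by decide +kernel) (by decide +kernel) (by norm_num) (by decide +kernel)
  refine ⟨C, hC, fun m => ?_⟩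
  rw [numIndepSets_congr (SimpleGraph.boxProdComm _ _), numIndepSets_boxProd_path]
  simpa using h m

theorem lt_exp_logEntropy : 1.503047782 < Real.exp logEntropy := by
  obtain ⟨C, hC, h⟩ := exists_gridCount_seven_le
  have hlog := log_div_le_logEntropy (q := 3) (c₁ := 27855098 / 1000000) one_pos hC
    (by norm_num) (by norm_num) (fun m => by simpa using pow_le_gridCount_eight m) h
  rw [Real.log_le_iff_le_exp (by norm_num)] at hlog
  -- `27.855098 / 18.532408 = 1.50304795…`
  refine lt_of_lt_of_le ?_ hlog
  norm_num

theorem exp_logEntropy_lt : Real.exp logEntropy < 1.5035149 := by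
  obtain ⟨C, hC, h⟩ := exists_cylinder_six_le
  have hlog := logEntropy_le_log_div (q := 3) (by norm_num) hC (by norm_num) h
  rw [← Real.lt_log_iff_exp_lt (by norm_num)]
  refine hlog.trans_lt ?_
  rw [div_lt_iff₀ (by norm_num), mul_comm,
    show 2 * ((3 : ℕ) : ℝ) = ((6 : ℕ) : ℝ) by norm_num, ← Real.log_pow]
  -- `1.5035149 ^ 6 = 11.551713…`
  exact Real.log_lt_log (by norm_num) (by norm_num)

end LatticeEntropy

theorem mainTheorem2 :
    ∃ η : ℝ, IsEntropyConstant planeLattice η ∧ IsEntropyConstant cylinderLattice η ∧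
      IsEntropyConstant torusLattice η ∧ 1.503047782 < η ∧ η < 1.5035149 :=
  ⟨Real.exp LatticeEntropy.logEntropy, LatticeEntropy.isEntropyConstant_plane,
    LatticeEntropy.isEntropyConstant_cylinder, LatticeEntropy.isEntropyConstant_torus,
    LatticeEntropy.lt_exp_logEntropy, LatticeEntropy.exp_logEntropy_lt⟩
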